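/- Let $H$ be a complex Hilbert space with norm $\|\cdot\|$, and let $T$ be a densely defined closed linear operator in $H$ with domain $D(T)\subseteq H$, null space $N(T)=\{x\in D(T): Tx=0\}$, range $\operatorname{ran}(T)=\{Tx: x\in D(T)\}$ and adjoint $T^*$. Let $\sigma(T)$ be the set of all $\mu\in\mathbb{C}$ for which $T-\mu I: D(T)\to H$ does not have an everywhere defined bounded inverse. Suppose that $T$ is totally paranormal, that is, for every $\lambda\in\mathbb{C}$, $$\|(T-\lambda I)x\|^2\le \|(T-\lambda I)^2x\|\,\|x\|\qquad\text{for all } x\in D((T-\lambda I)^2)=\{x\in D(T): (T-\lambda I)x\in D(T)\}.$$ Suppose further that $N(T)=N(T^*)$ and $0\in\sigma(T)$. Then $0$ is an isolated point of $\sigma(T)$ if and only if $\operatorname{ran}(T)$ is closed in $H$. -/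

import Mathlib

namespace UnboundedOperator

variable {H : Type*} [NormedAddCommGroup H] [InnerProductSpace ℂ H]

/-- The operator `T - μ I`, with domain `D(T - μ I) = D(T)`. -/
def shift (T : H →ₗ.[ℂ] H) (μ : ℂ) : H →ₗ.[ℂ] H where
  domain := T.domain
  toFun := T.toFun - μ • T.domain.subtype

/-- The null space `N(T) = {x ∈ D(T) : T x = 0}`, as a subspace of `H`. -/
def nullSpace (T : H →ₗ.[ℂ] H) : Submodule ℂ H :=
  (LinearMap.ker T.toFun).map T.domain.subtype

/-- The range `ran(T) = {T x : x ∈ D(T)}`, as a subspace of `H`. -/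
def rangeSpace (T : H →ₗ.[ℂ] H) : Submodule ℂ H :=
  LinearMap.range T.toFun

/-- `S` is paranormal: `‖S x‖ ^ 2 ≤ ‖S ^ 2 x‖ * ‖x‖` for every `x` in
`D(S ^ 2) = {x ∈ D(S) : S x ∈ D(S)}`. -/
def IsParanormal (S : H →ₗ.[ℂ] H) : Prop :=
  ∀ (x : S.domain) (hx : S x ∈ S.domain), ‖S x‖ ^ 2 ≤ ‖S ⟨S x, hx⟩‖ * ‖(x : H)‖

/-- `T` is totally paranormal: `T - μ I` is paranormal for every complex `μ`. -/
def IsTotallyParanormal (T : H →ₗ.[ℂ] H) : Prop :=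
  ∀ μ : ℂ, IsParanormal (shift T μ)

/-- `R` is a bounded, everywhere defined two-sided inverse of `S : D(S) → H`. -/
def IsBoundedInverse (S : H →ₗ.[ℂ] H) (R : H →L[ℂ] H) : Prop :=
  (∀ x : S.domain, R (S x) = x) ∧ ∀ y : H, ∃ h : R y ∈ S.domain, S ⟨R y, h⟩ = y

/-- The resolvent set: all `μ` such that `T - μ I : D(T) → H` is invertible with
inverse a bounded operator on `H`. -/
def resolventSet (T : H →ₗ.[ℂ] H) : Set ℂ :=
  {μ | ∃ R : H →L[ℂ] H, IsBoundedInverse (shift T μ) R}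

/-- The spectrum `σ(T)`, the complement of the resolvent set. -/
def spectrum (T : H →ₗ.[ℂ] H) : Set ℂ := (resolventSet T)ᶜ

/-- `z` is an isolated point of `A`: it belongs to `A` and some ball around it contains
no other point of `A`. -/
def IsIsolatedPoint (z : ℂ) (A : Set ℂ) : Prop :=
  z ∈ A ∧ ∃ r : ℝ, 0 < r ∧ Metric.ball z r ∩ A = {z}

end UnboundedOperator

namespace UnboundedOperator

open Filter Topology

variable {H : Type*} [NormedAddCommGroup H] [InnerProductSpace ℂ H]

/-! Density gives `N(T*) = ran(T)ᗮ`, so the hypothesis on null spaces reads `N(T) = ran(T)ᗮ`.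

Suppose 0 is isolated in the spectrum. Each resolvent `R μ` of `T` is a bounded paranormal operator,
hence its norm equals its spectral radius, and `‖R μ‖ ≤ 1/‖μ‖` near 0. So `μ • R μ` has a removable
singularity, filled in by an analytic `A`. Closedness of the graph puts the range of `A 0` in
`N(T)`. For `y` in `ran(T)ᗮᗮ` the vector `A 0 y` also lies in `ran(T)ᗮᗮ`, so it vanishes. Then `R μ
y` tends to `A'(0) y`, and closedness gives `T (A'(0) y) = y`. Hence `ran(T) = ran(T)ᗮᗮ` is closed.

Conversely, if the range is closed, `T` restricts to a bijection of `D(T) ∩ N(T)ᗮ` onto `N(T)ᗮ`,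
whose inverse is bounded by the closed graph theorem. A Neumann series on `N(T)ᗮ` and the scalar
`-μ⁻¹` on `N(T)` give the resolvent for small `μ ≠ 0`. -/

/-! ### Graphs, adjoints and the resolvent identity -/

theorem shift_apply (T : H →ₗ.[ℂ] H) (μ : ℂ) (x : T.domain) :
    shift T μ x = T x - μ • (x : H) := rfl

/-- Graph membership carries no dependent domain proofs and passes to limits when `T` is closed. -/
theorem isBoundedInverse_shift_iff {T : H →ₗ.[ℂ] H} {μ : ℂ} {R : H →L[ℂ] H} :
    IsBoundedInverse (shift T μ) R ↔
      (∀ p ∈ T.graph, R (p.2 - μ • p.1) = p.1) ∧ ∀ y, (R y, y + μ • R y) ∈ T.graph := by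
  constructor
  · rintro ⟨h₁, h₂⟩
    refine ⟨fun p hp => ?_, fun y => ?_⟩
    · obtain ⟨x, hx₁, hx₂⟩ := T.mem_graph_iff.1 hp
      rw [← hx₁, ← hx₂]
      exact h₁ x
    · obtain ⟨h, hy⟩ := h₂ y
      refine T.mem_graph_iff.2 ⟨⟨R y, h⟩, rfl, ?_⟩
      have hy' : T ⟨R y, h⟩ - μ • R y = y := hy
      exact sub_eq_iff_eq_add.1 hy'
  · rintro ⟨h₁, h₂⟩
    refine ⟨fun x => h₁ _ (T.mem_graph x), fun y => ?_⟩
    obtain ⟨x, hx₁, hx₂⟩ := T.mem_graph_iff.1 (h₂ y)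
    have hx₁' : (x : H) = R y := hx₁
    have h : R y ∈ T.domain := hx₁' ▸ x.2
    have hx : x = ⟨R y, h⟩ := Subtype.ext hx₁'
    refine ⟨h, ?_⟩
    change T ⟨R y, h⟩ - μ • R y = y
    rw [← hx, hx₂]
    simp

theorem mem_nullSpace_iff {T : H →ₗ.[ℂ] H} {x : H} : x ∈ nullSpace T ↔ (x, 0) ∈ T.graph := by
  rw [LinearPMap.mem_graph_iff, nullSpace, Submodule.mem_map]
  exact exists_congr fun y => and_comm

theorem mem_rangeSpace_iff {T : H →ₗ.[ℂ] H} {y : H} :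
    y ∈ rangeSpace T ↔ ∃ x, (x, y) ∈ T.graph := by
  constructor
  · rintro ⟨x, rfl⟩
    exact ⟨x, T.mem_graph x⟩
  · rintro ⟨x, hx⟩
    obtain ⟨z, -, hz⟩ := T.mem_graph_iff.1 hx
    exact ⟨z, hz⟩

theorem nullSpace_adjoint [CompleteSpace H] {T : H →ₗ.[ℂ] H} (hT : Dense (T.domain : Set H)) :
    nullSpace T.adjoint = (rangeSpace T)ᗮ := by
  ext y
  rw [mem_nullSpace_iff, LinearPMap.mem_graph_iff, Submodule.mem_orthogonal']
  constructor
  · rintro ⟨z, hz₁, hz₂⟩ _ ⟨x, rfl⟩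
    have := LinearPMap.adjoint_isFormalAdjoint hT z x
    rw [hz₂] at this
    have hz₁' : (z : H) = y := hz₁
    rw [← hz₁']
    simpa using this.symm
  · intro h
    have h' : ∀ x : T.domain, inner ℂ (0 : H) (x : H) = inner ℂ y (T x) := fun x => by
      rw [inner_zero_left]
      exact (h _ ⟨x, rfl⟩).symm
    exact ⟨⟨y, LinearPMap.mem_adjoint_domain_of_exists y ⟨0, h'⟩⟩, rfl,
      LinearPMap.adjoint_apply_eq hT _ h'⟩

/-- The first resolvent identity. -/
theorem IsBoundedInverse.sub_eq {T : H →ₗ.[ℂ] H} {μ ν : ℂ} {R S : H →L[ℂ] H}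
    (hR : IsBoundedInverse (shift T μ) R) (hS : IsBoundedInverse (shift T ν) S) :
    R - S = (μ - ν) • (R * S) := by
  rw [isBoundedInverse_shift_iff] at hR hS
  ext y
  have := hR.1 _ (hS.2 y)
  simp only [map_sub, map_add, map_smul] at this
  simp only [sub_apply, smul_apply,
    mul_apply_eq_comp, sub_smul]
  linear_combination (norm := module) this

/-- The bounded inverse of a paranormal operator is paranormal. -/
theorem IsParanormal.norm_sq_le_of_isBoundedInverse {S : H →ₗ.[ℂ] H} (hS : IsParanormal S)
    {R : H →L[ℂ] H} (hR : IsBoundedInverse S R) (y : H) :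
    ‖R y‖ ^ 2 ≤ ‖R (R y)‖ * ‖y‖ := by
  obtain ⟨h₁, e₁⟩ := hR.2 y
  obtain ⟨h₂, e₂⟩ := hR.2 (R y)
  have h := hS ⟨R (R y), h₂⟩ (by rw [e₂]; exact h₁)
  have e : (⟨S ⟨R (R y), h₂⟩, by rw [e₂]; exact h₁⟩ : S.domain) = ⟨R y, h₁⟩ := Subtype.ext e₂
  rw [e, e₁, e₂] at h
  linarith

/-! ### Powers of bounded paranormal operators -/

section BoundedParanormal

variable {R : H →L[ℂ] H}

/-- Induction: the case `n` at `R y`, combined with the `(n + 1)`-th power of the paranormal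
inequality at `y`, gives the next case after cancelling `‖R y‖ ^ n`. -/
theorem norm_pow_succ_le_of_paranormal (hR : ∀ y, ‖R y‖ ^ 2 ≤ ‖R (R y)‖ * ‖y‖) (n : ℕ) (y : H) :
    ‖R y‖ ^ (n + 1) ≤ ‖(R ^ (n + 1)) y‖ * ‖y‖ ^ n := by
  induction n generalizing y with
  | zero => simp
  | succ n ih =>
    rcases (norm_nonneg (R y)).eq_or_lt with h | h
    · rw [← h, zero_pow (by omega)]
      positivity
    have h₁ := ih (R y)
    have h₂ : ‖R y‖ ^ n * ‖R y‖ ^ (n + 2) ≤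
        ‖R y‖ ^ n * (‖(R ^ (n + 2)) y‖ * ‖y‖ ^ (n + 1)) := by
      calc ‖R y‖ ^ n * ‖R y‖ ^ (n + 2) = (‖R y‖ ^ 2) ^ (n + 1) := by ring
        _ ≤ (‖R (R y)‖ * ‖y‖) ^ (n + 1) := pow_le_pow_left₀ (by positivity) (hR y) _
        _ = ‖R (R y)‖ ^ (n + 1) * ‖y‖ ^ (n + 1) := mul_pow _ _ _
        _ ≤ (‖(R ^ (n + 1)) (R y)‖ * ‖R y‖ ^ n) * ‖y‖ ^ (n + 1) := by gcongr
        _ = _ := by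
          rw [pow_succ R (n + 1), mul_apply_eq_comp]
          ring
    exact le_of_mul_le_mul_left h₂ (by positivity)

theorem norm_pow_of_paranormal (hR : ∀ y, ‖R y‖ ^ 2 ≤ ‖R (R y)‖ * ‖y‖) (n : ℕ) :
    ‖R‖ ^ (n + 1) ≤ ‖R ^ (n + 1)‖ := by
  -- The `(n + 1)`-th root turns the pointwise estimate into a bound linear in `‖y‖`, as the
  -- operator norm requires.
  have h : ‖R‖ ≤ ‖R ^ (n + 1)‖ ^ ((n + 1 : ℕ) : ℝ)⁻¹ := by
    refine R.opNorm_le_bound (by positivity) fun y => ?_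
    refine le_of_pow_le_pow_left₀ (Nat.succ_ne_zero n) (by positivity) ?_
    rw [mul_pow, Real.rpow_inv_natCast_pow (norm_nonneg _) (Nat.succ_ne_zero n)]
    calc ‖R y‖ ^ (n + 1) ≤ ‖(R ^ (n + 1)) y‖ * ‖y‖ ^ n := norm_pow_succ_le_of_paranormal hR n y
      _ ≤ (‖R ^ (n + 1)‖ * ‖y‖) * ‖y‖ ^ n := by
        gcongr
        exact ContinuousLinearMap.le_opNorm _ _
      _ = _ := by rw [mul_assoc, ← pow_succ']
  calc ‖R‖ ^ (n + 1) ≤ (‖R ^ (n + 1)‖ ^ ((n + 1 : ℕ) : ℝ)⁻¹) ^ (n + 1) := by gcongr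
    _ = _ := Real.rpow_inv_natCast_pow (norm_nonneg _) (Nat.succ_ne_zero n)

/-- Bounded paranormal operators are normaloid. -/
theorem ofReal_norm_le_spectralRadius [CompleteSpace H]
    (hR : ∀ y, ‖R y‖ ^ 2 ≤ ‖R (R y)‖ * ‖y‖) :
    ENNReal.ofReal ‖R‖ ≤ spectralRadius ℂ R := by
  refine ge_of_tendsto (spectrum.pow_norm_pow_one_div_tendsto_nhds_spectralRadius R) ?_
  filter_upwards [eventually_ge_atTop 1] with n hn
  obtain ⟨n, rfl⟩ := Nat.exists_eq_succ_of_ne_zero (by omega : n ≠ 0)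
  refine ENNReal.ofReal_le_ofReal ?_
  rw [one_div]
  calc ‖R‖ = (‖R‖ ^ (n + 1)) ^ ((n + 1 : ℕ) : ℝ)⁻¹ :=
        (Real.pow_rpow_inv_natCast (norm_nonneg _) (Nat.succ_ne_zero n)).symm
    _ ≤ _ := Real.rpow_le_rpow (by positivity) (norm_pow_of_paranormal hR n) (by positivity)

end BoundedParanormal

/-! ### Growth and analyticity of the resolvent -/

/-- Nonzero spectral values of the resolvent at `μ` come from spectral values of `T`. -/
theorem IsBoundedInverse.mem_spectrum_of_mem {T : H →ₗ.[ℂ] H} {μ ν : ℂ} {R : H →L[ℂ] H}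
    (hR : IsBoundedInverse (shift T μ) R) (hν : ν ≠ 0) (h : ν ∈ _root_.spectrum ℂ R) :
    μ + ν⁻¹ ∈ spectrum T := by
  rintro ⟨S, hS⟩
  apply h
  have e₁ : S - R = ν⁻¹ • (S * R) := by simpa using hS.sub_eq hR
  have e₂ : S - R = ν⁻¹ • (R * S) := by
    have := hR.sub_eq hS
    rw [← neg_sub, this, ← neg_smul]
    congr 1
    ring
  rw [_root_.spectrum.mem_resolventSet_iff, Algebra.algebraMap_eq_smul_one]
  -- The two orders of the resolvent identity, `e₂` and `e₁`, make this a right and a left inverse.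
  refine ⟨⟨ν • 1 - R, ν⁻¹ • (1 + ν⁻¹ • S), ?_, ?_⟩, rfl⟩
  · rw [sub_mul, smul_mul_assoc, one_mul, smul_inv_smul₀ hν, mul_smul_comm, mul_add, mul_one,
      mul_smul_comm, ← e₂]
    simp
  · rw [mul_sub, mul_smul_comm, mul_one, smul_inv_smul₀ hν, smul_mul_assoc, add_mul, one_mul,
      smul_mul_assoc, ← e₁]
    simp

/-- The resolvent of a totally paranormal operator at `μ` has norm at most the inverse of any
lower bound for the distance from `μ` to the spectrum. -/
theorem IsTotallyParanormal.norm_le_inv [CompleteSpace H] {T : H →ₗ.[ℂ] H}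
    (hT : IsTotallyParanormal T) {μ : ℂ} {R : H →L[ℂ] H} (hR : IsBoundedInverse (shift T μ) R)
    {d : ℝ} (hd : 0 < d) (h : ∀ z ∈ spectrum T, d ≤ ‖z - μ‖) : ‖R‖ ≤ d⁻¹ := by
  have h₁ : ENNReal.ofReal ‖R‖ ≤ ENNReal.ofReal d⁻¹ := by
    refine (ofReal_norm_le_spectralRadius ((hT μ).norm_sq_le_of_isBoundedInverse hR)).trans ?_
    refine iSup₂_le fun ν hν => ?_
    change ‖ν‖ₑ ≤ _
    rw [← ofReal_norm]
    refine ENNReal.ofReal_le_ofReal ?_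
    rcases eq_or_ne ν 0 with rfl | h₀
    · simpa using hd.le
    · have := h _ (hR.mem_spectrum_of_mem h₀ hν)
      rw [add_sub_cancel_left, norm_inv] at this
      exact (le_inv_comm₀ hd (norm_pos_iff.2 h₀)).1 this
  exact (ENNReal.ofReal_le_ofReal_iff (by positivity)).1 h₁

/-- By the resolvent identity, local boundedness gives continuity, and the difference quotient is
exactly `R z * R μ`. -/
theorem hasDerivAt_resolvent [CompleteSpace H] {T : H →ₗ.[ℂ] H} {U : Set ℂ} {R : ℂ → H →L[ℂ] H}
    (hR : ∀ μ ∈ U, IsBoundedInverse (shift T μ) (R μ)) {μ : ℂ} (hU : U ∈ 𝓝 μ) {C : ℝ}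
    (hC : ∀ᶠ z in 𝓝 μ, ‖R z‖ ≤ C) : HasDerivAt R (R μ * R μ) μ := by
  have hμ := hR μ (mem_of_mem_nhds hU)
  have hcont : Tendsto R (𝓝 μ) (𝓝 (R μ)) := by
    rw [tendsto_iff_norm_sub_tendsto_zero]
    have h₀ : Tendsto (fun z : ℂ => ‖z - μ‖ * (C * ‖R μ‖)) (𝓝 μ) (𝓝 0) := by
      have : Continuous fun z : ℂ => ‖z - μ‖ * (C * ‖R μ‖) := by fun_prop
      simpa using this.tendsto μ
    refine squeeze_zero' (Eventually.of_forall fun _ => norm_nonneg _) ?_ h₀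
    filter_upwards [hU, hC] with z hz hCz
    rw [(hR z hz).sub_eq hμ, norm_smul]
    gcongr
    exact (norm_mul_le _ _).trans (by gcongr)
  rw [hasDerivAt_iff_tendsto_slope]
  refine ((hcont.mono_left nhdsWithin_le_nhds).mul_const (R μ)).congr' ?_
  filter_upwards [self_mem_nhdsWithin, mem_nhdsWithin_of_mem_nhds hU] with z hz hzU
  rw [slope_def_module, (hR z hzU).sub_eq hμ, inv_smul_smul₀ (sub_ne_zero.2 hz)]

/-! ### An isolated spectral point forces closed range -/

theorem rangeSpace_eq_orthogonal_of_isIsolatedPoint [CompleteSpace H] {T : H →ₗ.[ℂ] H}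
    (hT : T.IsClosed) (hp : IsTotallyParanormal T) (hN : nullSpace T = (rangeSpace T)ᗮ)
    (h : IsIsolatedPoint 0 (spectrum T)) : rangeSpace T = (rangeSpace T)ᗮᗮ := by
  obtain ⟨h₀, r, hr, hball⟩ := h
  have hex : ∀ μ : ℂ, ∃ S : H →L[ℂ] H, ‖μ‖ < r → μ ≠ 0 → IsBoundedInverse (shift T μ) S := by
    intro μ
    by_cases hμ : ‖μ‖ < r ∧ μ ≠ 0
    · by_contra! hcon
      have : μ ∈ Metric.ball 0 r ∩ spectrum T :=
        ⟨by simpa using hμ.1, fun ⟨S, hS⟩ => (hcon S).2.2 hS⟩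
      rw [hball] at this
      exact hμ.2 this
    · exact ⟨0, fun h₁ h₂ => absurd ⟨h₁, h₂⟩ hμ⟩
  choose R hR using hex
  -- Within radius `r / 2` the nearest spectral point is 0, since all others have norm at least `r`.
  have hbound : ∀ μ : ℂ, ‖μ‖ < r / 2 → μ ≠ 0 → ‖R μ‖ ≤ ‖μ‖⁻¹ := by
    intro μ hμ hμ₀
    refine hp.norm_le_inv (hR μ (by linarith) hμ₀) (norm_pos_iff.2 hμ₀) fun z hz => ?_
    by_cases hzr : ‖z‖ < r
    · have : z ∈ Metric.ball 0 r ∩ spectrum T := ⟨by simpa using hzr, hz⟩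
      rw [hball] at this
      rw [Set.mem_singleton_iff.1 this]
      simp
    · have := norm_sub_norm_le z μ
      linarith
  set s : Set ℂ := Metric.ball 0 (r / 2) with hs
  have hs₀ : s ∈ 𝓝 (0 : ℂ) := Metric.ball_mem_nhds _ (by linarith)
  have hmem : ∀ μ ∈ s \ {0}, ‖μ‖ < r / 2 ∧ μ ≠ 0 := fun μ hμ => ⟨by simpa [hs] using hμ.1, hμ.2⟩
  have hopen : IsOpen (s \ {0}) := Metric.isOpen_ball.sdiff isClosed_singleton
  have hinv : ∀ μ ∈ s \ {0}, IsBoundedInverse (shift T μ) (R μ) := fun μ hμ =>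
    hR μ (by linarith [(hmem μ hμ).1]) (hmem μ hμ).2
  have hdiff : DifferentiableOn ℂ (fun μ => μ • R μ) (s \ {0}) := by
    intro μ hμ
    have hd : DifferentiableAt ℂ R μ := by
      refine (hasDerivAt_resolvent hinv (hopen.mem_nhds hμ) (C := ‖μ‖⁻¹ + 1) ?_).differentiableAt
      have hc : ContinuousAt (fun z : ℂ => ‖z‖⁻¹) μ :=
        continuous_norm.continuousAt.inv₀ (norm_ne_zero_iff.2 hμ.2)
      filter_upwards [hopen.mem_nhds hμ, hc.eventually (eventually_lt_nhds (lt_add_one _))]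
        with z hz hz'
      exact (hbound z (hmem z hz).1 (hmem z hz).2).trans hz'.le
    exact (differentiableAt_id.smul hd).differentiableWithinAt
  have hbdd : BddAbove (norm ∘ (fun μ => μ • R μ) '' (s \ {0})) := by
    refine ⟨1, ?_⟩
    rintro _ ⟨μ, hμ, rfl⟩
    have := hbound μ (hmem μ hμ).1 (hmem μ hμ).2
    simp only [Function.comp_apply, norm_smul]
    calc ‖μ‖ * ‖R μ‖ ≤ ‖μ‖ * ‖μ‖⁻¹ := by gcongr
      _ ≤ 1 := mul_inv_le_one
  -- Riemann's removable singularity theorem.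
  have hA := (Complex.differentiableOn_update_limUnder_of_bddAbove hs₀ hdiff hbdd).differentiableAt
    hs₀
  set A := Function.update (fun μ => μ • R μ) 0 (limUnder (𝓝[≠] (0 : ℂ)) fun μ => μ • R μ)
  have hAμ : ∀ μ ≠ 0, A μ = μ • R μ := fun μ hμ => Function.update_of_ne hμ _ _
  have hev : ∀ᶠ μ in 𝓝[≠] (0 : ℂ), μ ∈ s \ {0} :=
    inter_mem (mem_nhdsWithin_of_mem_nhds hs₀) self_mem_nhdsWithin
  have hμ0 : Tendsto (fun μ : ℂ => μ) (𝓝[≠] 0) (𝓝 0) := tendsto_id.mono_left nhdsWithin_le_nhds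
  have hlim : ∀ y, Tendsto (fun μ => μ • R μ y) (𝓝[≠] 0) (𝓝 (A 0 y)) := by
    intro y
    have h₁ : Tendsto A (𝓝[≠] 0) (𝓝 (A 0)) :=
      hA.continuousAt.tendsto.mono_left nhdsWithin_le_nhds
    refine (((ContinuousLinearMap.apply ℂ H y).continuous.tendsto _).comp h₁).congr' ?_
    filter_upwards [self_mem_nhdsWithin] with μ hμ
    simp only [Function.comp_apply, ContinuousLinearMap.apply_apply]
    rw [hAμ μ hμ, smul_apply]
  have hgraph : ∀ μ ∈ s \ {0}, ∀ y, (R μ y, y + μ • R μ y) ∈ T.graph := fun μ hμ =>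
    (isBoundedInverse_shift_iff.1 (hinv μ hμ)).2
  have hnull : ∀ y, A 0 y ∈ (rangeSpace T)ᗮ := by
    intro y
    rw [← hN, mem_nullSpace_iff]
    have h₁ : Tendsto (fun μ => (μ • R μ y, μ • (y + μ • R μ y))) (𝓝[≠] 0)
        (𝓝 (A 0 y, (0 : ℂ) • (y + A 0 y))) :=
      (hlim y).prodMk_nhds (hμ0.smul ((hlim y).const_add y))
    rw [zero_smul] at h₁
    refine IsClosed.mem_of_tendsto hT h₁ ?_
    filter_upwards [hev] with μ hμ
    exact T.graph.smul_mem μ (hgraph μ hμ y)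
  refine le_antisymm (Submodule.le_orthogonal_orthogonal _) fun y hy => ?_
  have hAy : A 0 y = 0 := by
    have h₁ : A 0 y ∈ (rangeSpace T)ᗮᗮ := by
      refine (Submodule.isClosed_orthogonal _).mem_of_tendsto (hlim y) ?_
      filter_upwards [hev] with μ hμ
      have h₂ : μ • R μ y = (y + μ • R μ y) - y := by abel
      rw [SetLike.mem_coe, h₂]
      exact Submodule.sub_mem _
        (Submodule.le_orthogonal_orthogonal _ (mem_rangeSpace_iff.2 ⟨_, hgraph μ hμ y⟩)) hy
    exact inner_self_eq_zero.1 (Submodule.inner_right_of_mem_orthogonal (hnull y) h₁)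
  -- Since `A 0 y = 0`, the slope of `A` at 0 applied to `y` is `R μ y`.
  have hB : Tendsto (fun μ => R μ y) (𝓝[≠] 0) (𝓝 (deriv A 0 y)) := by
    refine (((ContinuousLinearMap.apply ℂ H y).continuous.tendsto _).comp
      (hasDerivAt_iff_tendsto_slope.1 hA.hasDerivAt)).congr' ?_
    filter_upwards [self_mem_nhdsWithin] with μ hμ
    simp only [Function.comp_apply, ContinuousLinearMap.apply_apply]
    rw [slope_def_module, sub_zero, smul_apply,
      sub_apply, hAy, sub_zero, hAμ μ hμ, smul_apply,
      inv_smul_smul₀ hμ]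
  have h₁ := hB.prodMk_nhds ((hlim y).const_add y)
  rw [hAy, add_zero] at h₁
  refine mem_rangeSpace_iff.2 ⟨deriv A 0 y, IsClosed.mem_of_tendsto hT h₁ ?_⟩
  filter_upwards [hev] with μ hμ
  exact hgraph μ hμ y

/-! ### Closed range isolates the spectral point -/

/-- A closed operator with closed range that is the orthogonal complement of its null space has a
bounded generalized inverse. -/
theorem exists_generalizedInverse [CompleteSpace H] {T : H →ₗ.[ℂ] H}
    (hT : T.IsClosed) (hN : nullSpace T = (rangeSpace T)ᗮ)
    (hran : IsClosed (rangeSpace T : Set H)) :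
    ∃ G : H →L[ℂ] H, (∀ y, (G y, y - (rangeSpace T)ᗮ.starProjection y) ∈ T.graph) ∧
      (∀ p ∈ T.graph, G p.2 = p.1 - (rangeSpace T)ᗮ.starProjection p.1) ∧
      (rangeSpace T)ᗮ.starProjection * G = 0 ∧ G * (rangeSpace T)ᗮ.starProjection = 0 := by
  set N := (rangeSpace T)ᗮ with hNdef
  set P := N.starProjection with hP
  have hran' : rangeSpace T = Nᗮ := by
    rw [hNdef, Submodule.orthogonal_orthogonal_eq_closure]
    exact (hran.submodule_topologicalClosure_eq).symm
  have hsub : ∀ y, y - P y ∈ Nᗮ := fun y => N.sub_starProjection_mem_orthogonal y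
  have hnull : ∀ y, (P y, (0 : H)) ∈ T.graph := fun y =>
    mem_nullSpace_iff.1 (hN ▸ N.starProjection_apply_mem y)
  have hfix : ∀ y ∈ Nᗮ, P y = 0 := fun y hy => N.starProjection_apply_eq_zero_iff.2 hy
  have huniq : ∀ x x' y, x ∈ Nᗮ → x' ∈ Nᗮ → (x, y) ∈ T.graph → (x', y) ∈ T.graph → x = x' := by
    intro x x' y hx hx' h h'
    have h₁ : (x - x', (0 : H)) ∈ T.graph := by simpa using T.graph.sub_mem h h'
    have h₂ : x - x' ∈ N := hN ▸ mem_nullSpace_iff.2 h₁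
    exact sub_eq_zero.1 (inner_self_eq_zero.1
      (Submodule.inner_right_of_mem_orthogonal h₂ (Nᗮ.sub_mem hx hx')))
  have hex : ∀ y, ∃ x, x ∈ Nᗮ ∧ (x, y - P y) ∈ T.graph := by
    intro y
    obtain ⟨x, hx⟩ := mem_rangeSpace_iff.1 (hran' ▸ hsub y : y - P y ∈ rangeSpace T)
    exact ⟨x - P x, hsub x, by simpa using T.graph.sub_mem hx (hnull x)⟩
  choose g hg₁ hg₂ using hex
  let G : H →ₗ[ℂ] H :=
    { toFun := g
      map_add' := fun a b => by
        refine huniq _ _ _ (hg₁ _) (Nᗮ.add_mem (hg₁ a) (hg₁ b)) (hg₂ _) ?_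
        have := T.graph.add_mem (hg₂ a) (hg₂ b)
        rwa [Prod.mk_add_mk, sub_add_sub_comm, ← map_add] at this
      map_smul' := fun c a => by
        refine huniq _ _ _ (hg₁ _) (Nᗮ.smul_mem c (hg₁ a)) (hg₂ _) ?_
        have := T.graph.smul_mem c (hg₂ a)
        rwa [Prod.smul_mk, smul_sub, ← map_smul] at this }
  -- By uniqueness in `Nᗮ`, the two closed conditions defining `g y` cut out exactly the graph of
  -- `G`.
  have hG : IsClosed (G.graph : Set (H × H)) := by
    have : (G.graph : Set (H × H)) = (fun p : H × H => p.2) ⁻¹' (Nᗮ : Set H) ∩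
        (fun p : H × H => (p.2, p.1 - P p.1)) ⁻¹' (T.graph : Set (H × H)) := by
      ext ⟨y, x⟩
      simp only [SetLike.mem_coe, LinearMap.mem_graph_iff, Set.mem_inter_iff, Set.mem_preimage]
      constructor
      · rintro rfl
        exact ⟨hg₁ y, hg₂ y⟩
      · rintro ⟨h₁, h₂⟩
        exact huniq _ _ _ h₁ (hg₁ y) h₂ (hg₂ y)
    rw [this]
    exact ((Submodule.isClosed_orthogonal _).preimage continuous_snd).inter
      (IsClosed.preimage (by fun_prop) hT)
  refine ⟨ContinuousLinearMap.ofIsClosedGraph hG, hg₂, ?_, ?_, ?_⟩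
  · rintro ⟨x, y⟩ hxy
    refine huniq _ _ y (hg₁ y) (hsub x) ?_ ?_
    · have := hg₂ y
      rwa [hfix y (hran' ▸ mem_rangeSpace_iff.2 ⟨x, hxy⟩), sub_zero] at this
    · simpa using T.graph.sub_mem hxy (hnull x)
  · ext y
    exact hfix _ (hg₁ y)
  · ext y
    refine huniq _ _ _ (hg₁ (P y)) Nᗮ.zero_mem (hg₂ (P y)) ?_
    rw [N.starProjection_eq_self_iff.2 (N.starProjection_apply_mem y), sub_self]
    exact T.graph.zero_mem

/-- If `G` is a bounded generalized inverse of `T`, with `P` the complementary projection onto the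
null space, then small nonzero `μ` lie in the resolvent set, with resolvent
`-μ⁻¹ P + G (1 - μ G)⁻¹`. -/
theorem mem_resolventSet_of_generalizedInverse [CompleteSpace H] {T : H →ₗ.[ℂ] H}
    {P G : H →L[ℂ] H} (hP : ∀ y, (P y, (0 : H)) ∈ T.graph) (hPT : ∀ p ∈ T.graph, P p.2 = 0)
    (hG₁ : ∀ y, (G y, y - P y) ∈ T.graph) (hG₂ : ∀ p ∈ T.graph, G p.2 = p.1 - P p.1)
    (hPG : P * G = 0) (hGP : G * P = 0)
    {μ : ℂ} (hμ : μ ≠ 0) (hμG : ‖μ • G‖ < 1) : μ ∈ resolventSet T := by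
  obtain ⟨K, hK₁, hK₂⟩ : ∃ K : H →L[ℂ] H, (1 - μ • G) * K = 1 ∧ K * (1 - μ • G) = 1 :=
    ⟨_, (Units.oneSub (μ • G) hμG).mul_inv, (Units.oneSub (μ • G) hμG).inv_mul⟩
  have hPK : P * K = P := by
    calc P * K = P * (1 - μ • G) * K := by rw [mul_sub, mul_smul_comm, hPG]; simp
      _ = P := by rw [mul_assoc, hK₁, mul_one]
  have hKP : K * P = P := by
    calc K * P = K * ((1 - μ • G) * P) := by rw [sub_mul, smul_mul_assoc, hGP]; simp
      _ = P := by rw [← mul_assoc, hK₂, one_mul]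
  have hGK : G * K = K * G := by
    calc G * K = K * (1 - μ • G) * (G * K) := by rw [hK₂, one_mul]
      _ = K * G * ((1 - μ • G) * K) := by
        simp only [mul_assoc, mul_sub, sub_mul, one_mul, smul_mul_assoc, mul_smul_comm]
      _ = K * G := by rw [hK₁, mul_one]
  refine ⟨-μ⁻¹ • P + G * K, isBoundedInverse_shift_iff.2 ⟨?_, fun y => ?_⟩⟩
  · rintro ⟨x, z⟩ hxz
    have e₁ : P z = 0 := hPT _ hxz
    have e₂ : G z = x - P x := hG₂ _ hxz
    have e₃ : K (P x) = P x := DFunLike.congr_fun hKP x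
    have e₄ : K x - μ • K (G x) = x := by simpa using DFunLike.congr_fun hK₂ x
    rw [hGK]
    simp only [add_apply, smul_apply, mul_apply_eq_comp, map_sub, map_smul, e₁, e₂,
      e₃, smul_zero]
    linear_combination (norm := module) e₄ + (inv_mul_cancel₀ hμ) • P x
  · have e₁ : P (K y) = P y := DFunLike.congr_fun hPK y
    have e₂ : K y - μ • G (K y) = y := DFunLike.congr_fun hK₁ y
    have h := T.graph.add_mem (T.graph.smul_mem (-μ⁻¹) (hP y)) (hG₁ (K y))
    convert h using 1
    refine Prod.ext rfl ?_
    simp only [add_apply, smul_apply, mul_apply_eq_comp, Prod.snd_add, Prod.smul_snd,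
      e₁, smul_add, smul_smul, smul_zero, mul_neg, mul_inv_cancel₀ hμ]
    linear_combination (norm := module) -e₂

theorem isIsolatedPoint_of_isClosed_rangeSpace [CompleteSpace H] {T : H →ₗ.[ℂ] H}
    (hT : T.IsClosed) (hN : nullSpace T = (rangeSpace T)ᗮ) (h₀ : (0 : ℂ) ∈ spectrum T)
    (hran : IsClosed (rangeSpace T : Set H)) : IsIsolatedPoint 0 (spectrum T) := by
  obtain ⟨G, hG₁, hG₂, hPG, hGP⟩ := exists_generalizedInverse hT hN hran
  -- Adding 1 covers `G = 0` and makes `‖μ • G‖ < 1` strict.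
  refine ⟨h₀, (‖G‖ + 1)⁻¹, by positivity, Set.Subset.antisymm ?_ ?_⟩
  · rintro μ ⟨hμ, hσ⟩
    by_contra hμ₀
    refine hσ (mem_resolventSet_of_generalizedInverse (fun y => ?_) (fun p hp => ?_) hG₁ hG₂ hPG
      hGP hμ₀ ?_)
    · rw [← mem_nullSpace_iff, hN]
      exact Submodule.starProjection_apply_mem _ y
    · exact (Submodule.starProjection_apply_eq_zero_iff _).2
        (Submodule.le_orthogonal_orthogonal _ (mem_rangeSpace_iff.2 ⟨_, hp⟩))
    · rw [mem_ball_zero_iff] at hμ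
      rw [norm_smul]
      calc ‖μ‖ * ‖G‖ ≤ (‖G‖ + 1)⁻¹ * ‖G‖ := by gcongr
        _ < (‖G‖ + 1)⁻¹ * (‖G‖ + 1) := by gcongr; exact lt_add_one _
        _ = 1 := inv_mul_cancel₀ (by positivity)
  · rintro _ rfl
    exact ⟨Metric.mem_ball_self (by positivity), h₀⟩

end UnboundedOperator

theorem theorem3p7 {H : Type*} [NormedAddCommGroup H] [InnerProductSpace ℂ H] [CompleteSpace H]
    (T : H →ₗ.[ℂ] H)
    (hdense : Dense (T.domain : Set H))
    (hclosed : T.IsClosed)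
    (hpara : UnboundedOperator.IsTotallyParanormal T)
    (hnull : UnboundedOperator.nullSpace T = UnboundedOperator.nullSpace T.adjoint)
    (hzero : (0 : ℂ) ∈ UnboundedOperator.spectrum T) :
    UnboundedOperator.IsIsolatedPoint 0 (UnboundedOperator.spectrum T) ↔
      IsClosed (UnboundedOperator.rangeSpace T : Set H) := by
  rw [UnboundedOperator.nullSpace_adjoint hdense] at hnull
  refine ⟨fun h => ?_,
    UnboundedOperator.isIsolatedPoint_of_isClosed_rangeSpace hclosed hnull hzero⟩
  rw [UnboundedOperator.rangeSpace_eq_orthogonal_of_isIsolatedPoint hclosed hpara hnull h]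
  exact Submodule.isClosed_orthogonal _
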